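/- Let $\omega=e^{2\pi i/3}$ and tile the complex plane by regular hexagons ("cells") of side length $1$, one of which has vertices $1\pm\omega^j$, $j\in\{0,1,2\}$. For positive integers $a\le 2b$, $b\le 2a$ with $a,b\ge2$, the $(a,b)$-benzel is the union of the cells lying entirely within the hexagon with vertices $\omega^j(a\omega+b)$ and $-\omega^j(a+b\omega)$, $j\in\{0,1,2\}$. A stone consists of the three cells around a vertex of the grid; it is a left or a right stone according to whether the triangle formed by the centers of its cells points to the left or to the right. A rising (respectively falling) bone consists of three consecutive cells whose centers lie on a line that makes an angle of $30^\circ$ (respectively $-30^\circ$) with the positive real axis. For $n\ge1$ let $T_n$ be the number of tilings of the $(n+2,2n+1)$-benzel by left stones, right stones, rising bones and falling bones, and put $T_0=1$. Then, for every $n\ge 0$, $T_n$ is the $n$-th large Schröder number, that is, the sequence determined by $L_0=1$ and $L_{n+1}=L_n+\sum_{i=0}^{n}L_iL_{n-i}$. Equivalently, as formal power series, $$\sum_{n=0}^\infty T_n x^n=\frac{1-x-\sqrt{1-6x+x^2}}{2x},$$ where $\sqrt{1-6x+x^2}$ is the square root with constant term $1$. -/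

import Mathlib

namespace Benzel

/-- The primitive cube root of unity `ω = exp (2πi/3)`. -/
noncomputable def omega : ℂ := Complex.exp (2 * Real.pi * Complex.I / 3)

/-- Indices of the cells of the hexagonal grid. -/
abbrev Cell : Type := ℤ × ℤ

/-- The center of a cell. One cell has center `1`. The step `1 - ω` leads to the
neighbour in direction `-30°`, the step `1 - ω ^ 2` to the neighbour in direction `30°`. -/
noncomputable def center (c : Cell) : ℂ :=
  1 + (c.1 : ℂ) * (1 - omega) + (c.2 : ℂ) * (1 - omega ^ 2)

/-- The cell as a closed regular hexagon of side length 1 in the complex plane, with vertices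
`z ± ω ^ j` (`j = 0, 1, 2`), where `z` is its center. -/
noncomputable def hexagon (c : Cell) : Set ℂ :=
  convexHull ℝ
    (Set.range (fun j : Fin 3 => center c + omega ^ (j : ℕ)) ∪
      Set.range (fun j : Fin 3 => center c - omega ^ (j : ℕ)))

/-- The (possibly degenerate) hexagon with vertices `ω ^ j * (a * ω + b)` and
`-ω ^ j * (a + b * ω)` for `j = 0, 1, 2`. -/
noncomputable def boundingHexagon (a b : ℕ) : Set ℂ :=
  convexHull ℝ
    (Set.range (fun j : Fin 3 => omega ^ (j : ℕ) * ((a : ℂ) * omega + (b : ℂ))) ∪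
      Set.range (fun j : Fin 3 => -(omega ^ (j : ℕ) * ((a : ℂ) + (b : ℂ) * omega))))

/-- The `(a, b)`-benzel, as the set of the cells lying entirely within the bounding hexagon. -/
def benzel (a b : ℕ) : Set Cell := {c | hexagon c ⊆ boundingHexagon a b}

/-- The five prototiles. -/
inductive Prototile where
  | leftStone
  | rightStone
  | risingBone
  | fallingBone
  | verticalBone

/-- The cells of a prototile in a reference position. A stone consists of the three cells around
a vertex of the grid; the triangle of their centers points to the left for the left stone and to
the right for the right stone. A bone consists of three consecutive cells with collinear centers,
in direction `30°` (rising), `-30°` (falling) or `90°` (vertical). -/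
def Prototile.cells : Prototile → Finset Cell
  | .leftStone => {(0, 0), (1, 0), (0, 1)}
  | .rightStone => {(0, 0), (-1, 0), (0, -1)}
  | .risingBone => {(0, 0), (0, 1), (0, 2)}
  | .fallingBone => {(0, 0), (1, 0), (2, 0)}
  | .verticalBone => {(0, 0), (-1, 1), (-2, 2)}

/-- The translate of the prototile `p` by the grid vector with coordinates `v`. -/
def Prototile.translate (p : Prototile) (v : ℤ × ℤ) : Finset Cell :=
  p.cells.image (fun c => c + v)

/-- A tiling of the region `R` by the prototiles in `P`: a set of translates of these
prototiles that are pairwise disjoint (share no cell) and have union `R`. -/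
structure IsTiling (P : Set Prototile) (R : Set Cell) (τ : Set (Finset Cell)) : Prop where
  exists_eq_translate : ∀ t ∈ τ, ∃ p ∈ P, ∃ v : ℤ × ℤ, t = p.translate v
  pairwiseDisjoint : ∀ s ∈ τ, ∀ t ∈ τ, s ≠ t → Disjoint s t
  iUnion_eq : ⋃ t ∈ τ, (t : Set Cell) = R

/-- The number of tilings of `R` by the prototiles in `P`. -/
noncomputable def numTilings (P : Set Prototile) (R : Set Cell) : ℕ :=
  {τ : Set (Finset Cell) | IsTiling P R τ}.ncard

end Benzel

/-!
In the coordinates of `Cell`, viewed as a square grid, the stones, the rising and the falling bones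
are the four ribbon trominoes: they have one cell on each of three consecutive diagonals
`x - y = c, c + 1, c + 2` (`exists_translate_iff_ribbon`). The benzel consists of the diagonals
`x - y + n + 1 = 0, ..., 3 * n + 1` (`benzel_eq_cells`), which are grouped by threes into layers
`0, ..., n`, the last of which lacks its third diagonal.

In layer `j` there are `n + 1 - j` cells on each of the first two diagonals (`n` for `j = 0`). In
every tiling the cells of these two diagonals are paired, horizontally for `1 ≤ j` and vertically
for `j = 0`, and a tile consists of such a pair and of an adjacent cell on the third diagonal of
layer `j` or of layer `j - 1`. The reason is `count_eq_zero_of_unpaired`: one wrong pair forces the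
next one, down to a cell without a partner. Along a layer, pairs and cells of the third diagonal
form a path, so a tiling of the layer is determined by the pair that is used by the preceding layer
and by the cell of the third diagonal (the hole) that is left to the following layer. The
hole cannot lie above that pair, and is adjacent to at most two pairs of the next layer.

Hence the number of tilings of the layers from `j` on, when in layer `j` only `d` pairs below the
used one are still to be covered, satisfies a recursion in `n - j` and `d`
(`count_cutLayer_add_one`, `count_withHole`), which is that of the Schröder triangle
(`schroderTriangle`). The functional equation of the generating function of the large Schröder
numbers gives `d ↦ coeff d (F ^ (n - j + 1 - d))` as its solution, and layer `0` with `d = n` gives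
the large Schröder numbers (`count_cells`).
-/

namespace Benzel

/-! ### Counting tilings by the tile at a chosen cell -/

theorem Prototile.translate_nonempty (p : Prototile) (v : ℤ × ℤ) : (p.translate v).Nonempty := by
  cases p <;> simp [Prototile.translate, Prototile.cells]

theorem IsTiling.subset {P : Set Prototile} {R : Set Cell} {τ : Set (Finset Cell)}
    (h : IsTiling P R τ) {t : Finset Cell} (ht : t ∈ τ) : (t : Set Cell) ⊆ R := by
  rw [← h.iUnion_eq]
  exact Set.subset_biUnion_of_mem (u := fun t : Finset Cell => (t : Set Cell)) ht

theorem finite_setOf_isTiling (P : Set Prototile) {R : Set Cell} (hR : R.Finite) :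
    {τ | IsTiling P R τ}.Finite := by
  have hA : {t : Finset Cell | (t : Set Cell) ⊆ R}.Finite := by
    refine (hR.toFinset.powerset.finite_toSet).subset fun t ht => ?_
    simpa [Finset.subset_iff, Set.subset_def] using ht
  exact hA.finite_subsets.subset fun τ hτ t ht => hτ.subset ht

theorem IsTiling.sdiff_singleton {P : Set Prototile} {R : Set Cell} {τ : Set (Finset Cell)}
    (h : IsTiling P R τ) {t : Finset Cell} (ht : t ∈ τ) : IsTiling P (R \ t) (τ \ {t}) where
  exists_eq_translate s hs := h.exists_eq_translate s hs.1
  pairwiseDisjoint s hs u hu := h.pairwiseDisjoint s hs.1 u hu.1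
  iUnion_eq := by
    ext c
    simp only [← h.iUnion_eq, Set.mem_iUnion, Set.mem_sdiff, Set.mem_singleton_iff,
      exists_prop, Finset.mem_coe]
    constructor
    · rintro ⟨s, ⟨hs, hst⟩, hc⟩
      exact ⟨⟨s, hs, hc⟩, fun hct =>
        Finset.disjoint_left.1 (h.pairwiseDisjoint s hs t ht hst) hc hct⟩
    · rintro ⟨⟨s, hs, hc⟩, hct⟩
      exact ⟨s, ⟨hs, fun e => hct (e ▸ hc)⟩, hc⟩

theorem IsTiling.insert {P : Set Prototile} {R : Set Cell} {t : Finset Cell}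
    {τ : Set (Finset Cell)} (h : IsTiling P (R \ t) τ)
    (ht : ∃ p ∈ P, ∃ v : ℤ × ℤ, t = p.translate v) (htR : (t : Set Cell) ⊆ R) :
    IsTiling P R (insert t τ) where
  exists_eq_translate s hs := by
    rcases hs with rfl | hs
    exacts [ht, h.exists_eq_translate s hs]
  pairwiseDisjoint := by
    have key : ∀ s ∈ τ, Disjoint s t := fun s hs =>
      Finset.disjoint_left.2 fun c hc hct => (h.subset hs hc).2 hct
    rintro s (rfl | hs) u (rfl | hu) hne
    exacts [(hne rfl).elim, (key u hu).symm, key s hs, h.pairwiseDisjoint s hs u hu hne]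
  iUnion_eq := by
    rw [Set.biUnion_insert, h.iUnion_eq, Set.union_sdiff_cancel htR]

theorem IsTiling.notMem_of_sdiff {P : Set Prototile} {R : Set Cell} {t : Finset Cell}
    {τ : Set (Finset Cell)} (h : IsTiling P (R \ t) τ) (ht : t.Nonempty) : t ∉ τ := fun hmem =>
  have ⟨_, hc⟩ := ht
  (h.subset hmem hc).2 hc

/-- The tilings of a finite region are sorted by the tile `t` that covers a chosen cell `c`;
candidates `t` whose complement has no tiling may be left out of the sum. -/
theorem numTilings_eq_sum {P : Set Prototile} {R : Set Cell} (hR : R.Finite) {c : Cell}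
    (hc : c ∈ R) (S : Finset (Finset Cell))
    (hS : ∀ t ∈ S, (∃ p ∈ P, ∃ v : ℤ × ℤ, t = p.translate v) ∧ c ∈ t ∧ (t : Set Cell) ⊆ R)
    (h0 : ∀ t : Finset Cell, (∃ p ∈ P, ∃ v : ℤ × ℤ, t = p.translate v) → c ∈ t →
      (t : Set Cell) ⊆ R → t ∉ S → numTilings P (R \ t) = 0) :
    numTilings P R = ∑ t ∈ S, numTilings P (R \ t) := by
  classical
  have hfin (Q : Set Cell) (hQ : Q ⊆ R) : {τ | IsTiling P Q τ}.Finite :=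
    finite_setOf_isTiling P (hR.subset hQ)
  have hsub (t : Finset Cell) : R \ (t : Set Cell) ⊆ R := Set.sdiff_subset
  have hunion : {τ | IsTiling P R τ} =
      ⋃ t ∈ S, (fun τ => insert t τ) '' {τ | IsTiling P (R \ t) τ} := by
    ext τ
    simp only [Set.mem_ofPred_eq, Set.mem_iUnion, Set.mem_image, exists_prop]
    constructor
    · intro h
      have hc' := hc
      rw [← h.iUnion_eq] at hc'
      simp only [Set.mem_iUnion, exists_prop, Finset.mem_coe] at hc'
      obtain ⟨t, ht, hct⟩ := hc'
      refine ⟨t, ?_, τ \ {t}, h.sdiff_singleton ht, by simp [Set.insert_eq_of_mem ht]⟩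
      by_contra htS
      have h1 := h0 t (h.exists_eq_translate t ht) hct (h.subset ht) htS
      rw [numTilings, Set.ncard_eq_zero (hfin _ (hsub t))] at h1
      exact Set.eq_empty_iff_forall_notMem.1 h1 _ (h.sdiff_singleton ht)
    · rintro ⟨t, ht, σ, hσ, rfl⟩
      exact hσ.insert (hS t ht).1 (hS t ht).2.2
  have hfinset : (hfin R subset_rfl).toFinset =
      S.biUnion fun t => ((hfin _ (hsub t)).toFinset).image fun τ => insert t τ := by
    ext τ
    have := Set.ext_iff.1 hunion τ
    simpa using this
  rw [numTilings, Set.ncard_eq_toFinset_card _ (hfin R subset_rfl), hfinset, Finset.card_biUnion]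
  · refine Finset.sum_congr rfl fun t ht => ?_
    rw [numTilings, Set.ncard_eq_toFinset_card _ (hfin _ (hsub t)), Finset.card_image_of_injOn]
    have hne : t.Nonempty := ⟨c, (hS t ht).2.1⟩
    intro σ hσ σ' hσ' he
    simp only [Set.Finite.coe_toFinset, Set.mem_ofPred_eq] at hσ hσ'
    have h1 : insert t σ \ {t} = insert t σ' \ {t} := congrArg (· \ {t}) he
    rwa [Set.insert_sdiff_self_of_notMem (hσ.notMem_of_sdiff hne),
      Set.insert_sdiff_self_of_notMem (hσ'.notMem_of_sdiff hne)] at h1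
  · intro s hs t ht hst
    refine Finset.disjoint_left.2 fun τ hτs hτt => ?_
    simp only [Finset.mem_image, Set.Finite.mem_toFinset, Set.mem_ofPred_eq] at hτs hτt
    obtain ⟨σ, hσ, rfl⟩ := hτs
    obtain ⟨σ', hσ', he⟩ := hτt
    have h1 := hσ.insert (hS s hs).1 (hS s hs).2.2
    have h2 : t ∈ insert s σ := he ▸ Set.mem_insert t σ'
    exact Finset.disjoint_left.1
      (h1.pairwiseDisjoint s (Set.mem_insert s σ) t h2 hst) (hS s hs).2.1 (hS t ht).2.1

theorem numTilings_empty (P : Set Prototile) : numTilings P ∅ = 1 := by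
  rw [numTilings, Set.ncard_eq_one]
  refine ⟨∅, Set.eq_singleton_iff_unique_mem.2 ⟨⟨by simp, by simp, by simp⟩, fun τ hτ => ?_⟩⟩
  refine Set.eq_empty_iff_forall_notMem.2 fun t ht => ?_
  obtain ⟨p, -, v, rfl⟩ := hτ.exists_eq_translate t ht
  obtain ⟨c, hc⟩ := p.translate_nonempty v
  exact hτ.subset ht hc

/-! ### Stones and non-vertical bones as ribbons -/

/-- The four prototiles other than the vertical bone. -/
abbrev nonVertical : Set Prototile :=
  {Prototile.leftStone, Prototile.rightStone, Prototile.risingBone, Prototile.fallingBone}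

/-- The ribbon of three cells that starts at `(x, y)`, where each of the two steps is `(1, 0)` if
the corresponding one of the parameters `e`, `f` is `1`, and `(0, -1)` if it is `0`. Each step
raises the difference of the coordinates by `1`. -/
def ribbon (x y e f : ℤ) : Finset Cell :=
  {(x, y), (x + e, y - 1 + e), (x + e + f, y - 2 + e + f)}

/-- In the coordinates of `Cell`, viewed as a square grid, the four prototiles are the ribbon
trominoes. -/
theorem exists_translate_iff_ribbon (t : Finset Cell) :
    (∃ p ∈ nonVertical, ∃ v : ℤ × ℤ, t = p.translate v) ↔
      ∃ x y e f : ℤ, (0 ≤ e ∧ e ≤ 1) ∧ (0 ≤ f ∧ f ≤ 1) ∧ t = ribbon x y e f := by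
  constructor
  · rintro ⟨p, hp, ⟨v, w⟩, rfl⟩
    rcases hp with rfl | rfl | rfl | rfl
    · refine ⟨v, w + 1, 0, 1, by simp, by simp, ?_⟩
      ext ⟨a, b⟩
      simp [Prototile.translate, Prototile.cells, ribbon]
      omega
    · refine ⟨v - 1, w, 1, 0, by simp, by simp, ?_⟩
      ext ⟨a, b⟩
      simp [Prototile.translate, Prototile.cells, ribbon]
      omega
    · refine ⟨v, w + 2, 0, 0, by simp, by simp, ?_⟩
      ext ⟨a, b⟩
      simp [Prototile.translate, Prototile.cells, ribbon]
      omega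
    · refine ⟨v, w, 1, 1, by simp, by simp, ?_⟩
      ext ⟨a, b⟩
      simp [Prototile.translate, Prototile.cells, ribbon]
      omega
  · rintro ⟨x, y, e, f, he, hf, rfl⟩
    obtain rfl | rfl : e = 0 ∨ e = 1 := by omega
    all_goals obtain rfl | rfl : f = 0 ∨ f = 1 := by omega
    · refine ⟨.risingBone, by simp, (x, y - 2), ?_⟩
      ext ⟨a, b⟩
      simp [Prototile.translate, Prototile.cells, ribbon]
      omega
    · refine ⟨.leftStone, by simp, (x, y - 1), ?_⟩
      ext ⟨a, b⟩
      simp [Prototile.translate, Prototile.cells, ribbon]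
      omega
    · refine ⟨.rightStone, by simp, (x + 1, y), ?_⟩
      ext ⟨a, b⟩
      simp [Prototile.translate, Prototile.cells, ribbon]
      omega
    · refine ⟨.fallingBone, by simp, (x, y), ?_⟩
      ext ⟨a, b⟩
      simp [Prototile.translate, Prototile.cells, ribbon]
      omega

/-- `count R` is the number of tilings of `R` by stones, rising bones and falling bones. -/
noncomputable abbrev count (R : Set Cell) : ℕ := numTilings nonVertical R

theorem coe_ribbon_subset_iff {x y e f : ℤ} {R : Set Cell} :
    (ribbon x y e f : Set Cell) ⊆ R ↔
      (x, y) ∈ R ∧ (x + e, y - 1 + e) ∈ R ∧ (x + e + f, y - 2 + e + f) ∈ R := by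
  simp [ribbon, Set.insert_subset_iff]

theorem mem_ribbon {x y e f a b : ℤ} :
    (a, b) ∈ ribbon x y e f ↔
      a = x ∧ b = y ∨ a = x + e ∧ b = y - 1 + e ∨ a = x + e + f ∧ b = y - 2 + e + f := by
  simp [ribbon]

/-- `numTilings_eq_sum` for ribbons, in terms of coordinates. -/
theorem count_eq_sum {R : Set Cell} (hR : R.Finite) {a b : ℤ} (hab : (a, b) ∈ R)
    (S : Finset (Finset Cell))
    (hS : ∀ t ∈ S, ∃ x y e f : ℤ, (0 ≤ e ∧ e ≤ 1) ∧ (0 ≤ f ∧ f ≤ 1) ∧ (a, b) ∈ ribbon x y e f ∧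
      ((x, y) ∈ R ∧ (x + e, y - 1 + e) ∈ R ∧ (x + e + f, y - 2 + e + f) ∈ R) ∧
      t = ribbon x y e f)
    (h0 : ∀ x y e f : ℤ, (0 ≤ e ∧ e ≤ 1) → (0 ≤ f ∧ f ≤ 1) →
      (a = x ∧ b = y ∨ a = x + e ∧ b = y - 1 + e ∨ a = x + e + f ∧ b = y - 2 + e + f) →
      (x, y) ∈ R → (x + e, y - 1 + e) ∈ R → (x + e + f, y - 2 + e + f) ∈ R →
      ribbon x y e f ∈ S ∨ count (R \ ribbon x y e f) = 0) :
    count R = ∑ t ∈ S, count (R \ t) := by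
  refine numTilings_eq_sum hR hab S (fun t ht => ?_) fun t ht hct htR htS => ?_
  · obtain ⟨x, y, e, f, he, hf, hmem, hsub, rfl⟩ := hS t ht
    exact ⟨(exists_translate_iff_ribbon _).2 ⟨x, y, e, f, he, hf, rfl⟩, hmem,
      coe_ribbon_subset_iff.2 hsub⟩
  · obtain ⟨x, y, e, f, he, hf, rfl⟩ := (exists_translate_iff_ribbon _).1 ht
    obtain ⟨h1, h2, h3⟩ := coe_ribbon_subset_iff.1 htR
    exact (h0 x y e f he hf (mem_ribbon.1 hct) h1 h2 h3).resolve_left htS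

theorem count_eq_zero {R : Set Cell} (hR : R.Finite) {a b : ℤ} (hab : (a, b) ∈ R)
    (h0 : ∀ x y e f : ℤ, (0 ≤ e ∧ e ≤ 1) → (0 ≤ f ∧ f ≤ 1) →
      (a = x ∧ b = y ∨ a = x + e ∧ b = y - 1 + e ∨ a = x + e + f ∧ b = y - 2 + e + f) →
      (x, y) ∈ R → (x + e, y - 1 + e) ∈ R → (x + e + f, y - 2 + e + f) ∈ R →
      count (R \ ribbon x y e f) = 0) :
    count R = 0 := by
  rw [count_eq_sum hR hab ∅ (by simp)
    fun x y e f he hf hm h1 h2 h3 => .inr (h0 x y e f he hf hm h1 h2 h3)]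
  simp

theorem count_eq_of_forced {R : Set Cell} (hR : R.Finite) {a b : ℤ} (x₀ y₀ e₀ f₀ : ℤ)
    (he₀ : 0 ≤ e₀ ∧ e₀ ≤ 1) (hf₀ : 0 ≤ f₀ ∧ f₀ ≤ 1) (hab : (a, b) ∈ ribbon x₀ y₀ e₀ f₀)
    (hsub : (x₀, y₀) ∈ R ∧ (x₀ + e₀, y₀ - 1 + e₀) ∈ R ∧ (x₀ + e₀ + f₀, y₀ - 2 + e₀ + f₀) ∈ R)
    (h0 : ∀ x y e f : ℤ, (0 ≤ e ∧ e ≤ 1) → (0 ≤ f ∧ f ≤ 1) →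
      (a = x ∧ b = y ∨ a = x + e ∧ b = y - 1 + e ∨ a = x + e + f ∧ b = y - 2 + e + f) →
      (x, y) ∈ R → (x + e, y - 1 + e) ∈ R → (x + e + f, y - 2 + e + f) ∈ R →
      (x = x₀ ∧ y = y₀ ∧ e = e₀ ∧ f = f₀) ∨ count (R \ ribbon x y e f) = 0) :
    count R = count (R \ ribbon x₀ y₀ e₀ f₀) := by
  rw [count_eq_sum hR (coe_ribbon_subset_iff.2 hsub hab) {ribbon x₀ y₀ e₀ f₀}]
  · simp
  · intro t ht
    exact ⟨x₀, y₀, e₀, f₀, he₀, hf₀, hab, hsub, Finset.mem_singleton.1 ht⟩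
  · intro x y e f he hf hm h1 h2 h3
    rcases h0 x y e f he hf hm h1 h2 h3 with ⟨rfl, rfl, rfl, rfl⟩ | h
    exacts [.inl (Finset.mem_singleton_self _), .inr h]

theorem count_eq_add {R : Set Cell} (hR : R.Finite) {a b : ℤ} (x₀ y₀ e₀ f₀ x₁ y₁ e₁ f₁ : ℤ)
    (he₀ : 0 ≤ e₀ ∧ e₀ ≤ 1) (hf₀ : 0 ≤ f₀ ∧ f₀ ≤ 1) (hab₀ : (a, b) ∈ ribbon x₀ y₀ e₀ f₀)
    (hsub₀ : (x₀, y₀) ∈ R ∧ (x₀ + e₀, y₀ - 1 + e₀) ∈ R ∧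
      (x₀ + e₀ + f₀, y₀ - 2 + e₀ + f₀) ∈ R)
    (he₁ : 0 ≤ e₁ ∧ e₁ ≤ 1) (hf₁ : 0 ≤ f₁ ∧ f₁ ≤ 1) (hab₁ : (a, b) ∈ ribbon x₁ y₁ e₁ f₁)
    (hsub₁ : (x₁, y₁) ∈ R ∧ (x₁ + e₁, y₁ - 1 + e₁) ∈ R ∧
      (x₁ + e₁ + f₁, y₁ - 2 + e₁ + f₁) ∈ R)
    (hne : ∃ u v, (u, v) ∈ ribbon x₀ y₀ e₀ f₀ ∧ (u, v) ∉ ribbon x₁ y₁ e₁ f₁)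
    (h0 : ∀ x y e f : ℤ, (0 ≤ e ∧ e ≤ 1) → (0 ≤ f ∧ f ≤ 1) →
      (a = x ∧ b = y ∨ a = x + e ∧ b = y - 1 + e ∨ a = x + e + f ∧ b = y - 2 + e + f) →
      (x, y) ∈ R → (x + e, y - 1 + e) ∈ R → (x + e + f, y - 2 + e + f) ∈ R →
      (x = x₀ ∧ y = y₀ ∧ e = e₀ ∧ f = f₀) ∨ (x = x₁ ∧ y = y₁ ∧ e = e₁ ∧ f = f₁) ∨
        count (R \ ribbon x y e f) = 0) :
    count R = count (R \ ribbon x₀ y₀ e₀ f₀) + count (R \ ribbon x₁ y₁ e₁ f₁) := by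
  have hne' : ribbon x₀ y₀ e₀ f₀ ≠ ribbon x₁ y₁ e₁ f₁ := by
    obtain ⟨u, v, h, h'⟩ := hne
    exact fun he => h' (he ▸ h)
  rw [count_eq_sum hR (coe_ribbon_subset_iff.2 hsub₀ hab₀)
    {ribbon x₀ y₀ e₀ f₀, ribbon x₁ y₁ e₁ f₁}, Finset.sum_pair hne']
  · intro t ht
    rcases Finset.mem_insert.1 ht with rfl | ht
    · exact ⟨x₀, y₀, e₀, f₀, he₀, hf₀, hab₀, hsub₀, rfl⟩
    · exact ⟨x₁, y₁, e₁, f₁, he₁, hf₁, hab₁, hsub₁, Finset.mem_singleton.1 ht⟩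
  · intro x y e f he hf hm h1 h2 h3
    rcases h0 x y e f he hf hm h1 h2 h3 with ⟨rfl, rfl, rfl, rfl⟩ | ⟨rfl, rfl, rfl, rfl⟩ | h
    exacts [.inl (by simp), .inl (by simp), .inr h]

/-! ### Forced ribbons -/

/-- Let `K` be the smallest value of `x - y` on `R`. Every cell `(x, y)` of `R` with `x - y = K`
begins a ribbon, whose second cell is `(x + 1, y)` or `(x, y - 1)`. If for one `y` the first
option is missing, the second one is taken, which makes the first option missing for `y - 1`, and
so on, until a cell is met for which both options are missing. -/
theorem count_eq_zero_of_unpaired (K P : ℤ) (k : ℕ) :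
    ∀ R : Set Cell, R.Finite → (∀ x y, (x, y) ∈ R → K ≤ x - y) →
      (∀ x y, (x, y) ∈ R → x - y = K + 1 → P ≤ y → y < P + k → (x - 1, y) ∈ R) →
      (K + P, P - 1) ∉ R → (K + P + k, P + k) ∈ R → (K + P + k + 1, P + k) ∉ R →
      count R = 0 := by
  induction k with
  | zero =>
    intro R hR hmin hpair hbot h3 h4
    refine count_eq_zero hR h3 fun x y e f he hf hm m1 m2 m3 => ?_
    exfalso
    have := hmin _ _ m1
    obtain ⟨rfl, rfl⟩ : x = K + P ∧ y = P := by push_cast at hm; omega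
    obtain rfl | rfl : e = 0 ∨ e = 1 := by omega
    · exact hbot (by convert m2 using 2 <;> ring)
    · exact h4 (by convert m2 using 2 <;> push_cast <;> ring)
  | succ k ih =>
    intro R hR hmin hpair hbot h3 h4
    refine count_eq_zero hR h3 fun x y e f he hf hm m1 m2 m3 => ?_
    have := hmin _ _ m1
    push_cast at *
    obtain ⟨rfl, rfl⟩ : x = K + P + (k + 1) ∧ y = P + (k + 1) := by omega
    obtain rfl | rfl : e = 0 ∨ e = 1 := by omega
    · have h5 : (K + P + k, P + k) ∈ R := by
        have := hpair (K + P + k + 1) (P + k) (by convert m2 using 2 <;> ring)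
          (by ring) (by omega) (by omega)
        convert this using 2
        ring
      refine ih _ hR.sdiff (fun x y h => hmin x y h.1) (fun x y h h' hy hy' => ?_)
        (fun h => hbot h.1) ⟨h5, ?_⟩ fun h => h.2 ?_
      · refine ⟨hpair x y h.1 h' hy (by omega), ?_⟩
        rw [Finset.mem_coe, mem_ribbon]
        omega
      · rw [Finset.mem_coe, mem_ribbon]
        omega
      · rw [Finset.mem_coe, mem_ribbon]
        omega
    · exact (h4 (by convert m2 using 2; ring)).elim

/-- The cells `(x, y)` with `x - y ∈ {K, K + 1}` and `P ≤ y < Y`, or `x - y = K + 2` and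
`P - 1 ≤ y < Y - 1`. They form `Y - P` parallel right stones. -/
def block (K P Y : ℤ) : Set Cell :=
  {p | (p.1 - p.2 = K ∨ p.1 - p.2 = K + 1) ∧ P ≤ p.2 ∧ p.2 < Y ∨
    p.1 - p.2 = K + 2 ∧ P - 1 ≤ p.2 ∧ p.2 < Y - 1}

/-- If `X` has no cell on the lowest two diagonals `x - y = K, K + 1` next to the block or above it,
and none on the third diagonal that could replace a cell of the block, then the block can only be
tiled by its parallel right stones. They are peeled off from the top: a ribbon that begins at the
cell `(K + 1 + y, y)` would leave `(K + y, y)` unpaired. -/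
theorem count_union_block (X : Set Cell) (K P : ℤ) (k : ℕ)
    (hX : ∀ x y, (x, y) ∈ X → K ≤ x - y ∧ (x - y ≤ K + 1 → y < P - 1) ∧
      (x - y = K + 2 → y < P - 1 ∨ P + k ≤ y))
    (hfin : (X ∪ block K P (P + k)).Finite) : count (X ∪ block K P (P + k)) = count X := by
  induction k with
  | zero =>
    congr 1
    ext ⟨x, y⟩
    simp only [block, Set.mem_union, Set.mem_ofPred_eq]
    push_cast
    constructor
    · rintro (h | h)
      exacts [h, by omega]
    · exact .inl
  | succ k ih =>
    have hmem : ∀ x y, (x, y) ∈ X ∪ block K P (P + (k + 1 : ℕ)) → K ≤ x - y ∧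
        (x - y ≤ K + 1 → y < P - 1 ∨ P ≤ y ∧ y < P + k + 1) ∧
        (x - y = K + 2 → y < P + k ∨ P + k + 1 ≤ y) := by
      rintro x y (h | h)
      · have := hX x y h
        push_cast at this
        omega
      · simp only [block, Set.mem_ofPred_eq] at h
        push_cast at h
        omega
    have hsub : X ∪ block K P (P + k) ⊆ X ∪ block K P (P + (k + 1 : ℕ)) := by
      refine Set.union_subset_union_right X fun ⟨x, y⟩ h => ?_
      simp only [block, Set.mem_ofPred_eq] at h ⊢
      push_cast
      omega
    have hblock : ∀ x y, (x, y) ∈ block K P (P + (k + 1 : ℕ)) →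
        (x, y) ∈ X ∪ block K P (P + (k + 1 : ℕ)) := fun x y h => .inr h
    rw [count_eq_of_forced hfin (a := K + 1 + (P + k)) (b := P + k) (K + (P + k)) (P + k) 1 0]
    · rw [← ih (fun x y h => ?_) (hfin.subset hsub)]
      · congr 1
        ext ⟨x, y⟩
        rw [Set.mem_sdiff, Finset.mem_coe, mem_ribbon]
        simp only [block, Set.mem_union, Set.mem_ofPred_eq]
        push_cast
        constructor
        · rintro ⟨h | h, h'⟩
          exacts [.inl h, .inr (by omega)]
        · rintro (h | h)
          · have := hX x y h
            push_cast at this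
            exact ⟨.inl h, by omega⟩
          · exact ⟨.inr (by omega), by omega⟩
      · have := hX x y h
        push_cast at this
        omega
    · omega
    · omega
    · rw [mem_ribbon]
      omega
    · refine ⟨hblock _ _ ?_, hblock _ _ ?_, hblock _ _ ?_⟩ <;>
      · simp only [block, Set.mem_ofPred_eq]
        push_cast
        omega
    · intro x y e f he hf hm m1 m2 m3
      have n1 := hmem _ _ m1
      have n2 := hmem _ _ m2
      have n3 := hmem _ _ m3
      by_cases hx : x - y = K
      · left
        omega
      · -- The ribbon begins at `(K + 1 + (P + k), P + k)`, so it leaves the cell to the left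
        -- of its first cell unpaired.
        right
        obtain ⟨rfl, rfl⟩ : x = K + 1 + (P + k) ∧ y = P + k := by omega
        refine count_eq_zero_of_unpaired K P k _ hfin.sdiff (fun x y h => (hmem x y h.1).1)
          (fun x y h h' hy hy' => ⟨hblock _ _ ?_, ?_⟩) (fun h => ?_) ⟨hblock _ _ ?_, ?_⟩
          fun h => h.2 ?_
        · simp only [block, Set.mem_ofPred_eq]
          push_cast
          omega
        · rw [Finset.mem_coe, mem_ribbon]
          omega
        · have := hmem _ _ h.1
          omega
        · simp only [block, Set.mem_ofPred_eq]
          push_cast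
          omega
        · rw [Finset.mem_coe, mem_ribbon]
          omega
        · rw [Finset.mem_coe, mem_ribbon]
          omega

/-! ### The layers of the benzel -/

/-- The cells of the `(n + 2, 2 * n + 1)`-benzel, by inequalities. The difference `x - y` takes the
values from `-(n + 1)` to `2 * n`; the cells with `x - y + n + 1 ∈ {3 * j, 3 * j + 1, 3 * j + 2}`
are called layer `j`. -/
def cells (n : ℤ) : Set Cell :=
  {p | (-(n + 2) ≤ p.1 + 2 * p.2 ∧ p.1 + 2 * p.2 ≤ 2 * n - 1) ∧
    (-(n + 1) ≤ p.1 - p.2 ∧ p.1 - p.2 ≤ 2 * n) ∧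
    (-(2 * n + 1) ≤ 2 * p.1 + p.2 ∧ 2 * p.1 + p.2 ≤ n)}

/-- The layers from `j` on, with layer `j` cut off at height `d - j`. For `1 ≤ j < n` and
`0 ≤ d ≤ n - j`, what is left of layer `j` are `d` horizontal pairs of cells with
`x - y + n + 1 ∈ {3 * j, 3 * j + 1}`, and `d + 1` cells with `x - y + n + 1 = 3 * j + 2`. -/
def cutLayer (n j d : ℤ) : Set Cell :=
  {p | p ∈ cells n ∧ 3 * j - n - 1 ≤ p.1 - p.2 ∧ (p.1 - p.2 ≤ 3 * j - n + 1 → p.2 < d - j)}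

/-- The layers after layer `j`, and the one cell of layer `j` with `x - y + n + 1 = 3 * j + 2` and
`y = h - j - 1`. -/
def withHole (n j h : ℤ) : Set Cell :=
  {p | p ∈ cells n ∧ 3 * j - n + 1 ≤ p.1 - p.2 ∧ (p.1 - p.2 = 3 * j - n + 1 → p.2 = h - j - 1)}

theorem finite_cells (n : ℤ) : (cells n).Finite := by
  refine (Set.finite_Icc ((-(3 * n + 3), -(3 * n + 3)) : ℤ × ℤ) (3 * n + 3, 3 * n + 3)).subset ?_
  rintro ⟨x, y⟩ h
  simp only [cells, Set.mem_ofPred_eq] at h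
  simp only [Set.mem_Icc, Prod.mk_le_mk]
  omega

theorem finite_of_subset_cells {n : ℤ} {R : Set Cell} (h : ∀ p ∈ R, p ∈ cells n) : R.Finite :=
  (finite_cells n).subset h

/-- Once the hole is covered by a ribbon through one of the horizontal pairs of layer `j + 1`, that
layer falls apart into its part below this pair and a block above it. -/
theorem count_withHole_sdiff {n j h e : ℤ} (hj : 0 ≤ j) (he : 0 ≤ e ∧ e ≤ 1)
    (hd : 0 ≤ h - 1 + e) (hd' : h - 1 + e ≤ n - j - 1) :
    count (withHole n j h \ ribbon (2 * j - n + h) (h - j - 1) e 1) =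
      count (cutLayer n (j + 1) (h - 1 + e)) := by
  obtain ⟨k, hk⟩ : ∃ k : ℕ, (k : ℤ) = n - j - 1 - (h - 1 + e) := ⟨_, Int.toNat_of_nonneg (by omega)⟩
  have heq : withHole n j h \ ribbon (2 * j - n + h) (h - j - 1) e 1 =
      cutLayer n (j + 1) (h - 1 + e) ∪
        block (3 * (j + 1) - n - 1) (h - 1 + e - j) (h - 1 + e - j + k) := by
    ext ⟨x, y⟩
    rw [Set.mem_sdiff, Finset.mem_coe, mem_ribbon]
    simp only [withHole, cutLayer, block, cells, Set.mem_union, Set.mem_ofPred_eq]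
    omega
  rw [heq, count_union_block]
  · intro x y hxy
    simp only [cutLayer, Set.mem_ofPred_eq] at hxy
    omega
  · rw [← heq]
    exact finite_of_subset_cells fun p hp => hp.1.1

/-- A ribbon that covers the hole and one cell each of two horizontal pairs of layer `j + 1` leaves
the other cell of the lower pair unpaired. -/
theorem count_withHole_sdiff_eq_zero {n j h e : ℤ} (hj : 0 ≤ j) (he : 0 ≤ e ∧ e ≤ 1)
    (hmem : (2 * j - n + h + e, h - j - 3 + e) ∈ withHole n j h) :
    count (withHole n j h \ ribbon (2 * j - n + h) (h - j - 1) e 0) = 0 := by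
  simp only [withHole, cells, Set.mem_ofPred_eq] at hmem
  obtain ⟨k, hk⟩ : ∃ k : ℕ, (k : ℤ) = h - 2 + e := ⟨_, Int.toNat_of_nonneg (by omega)⟩
  refine count_eq_zero_of_unpaired (3 * (j + 1) - n - 1) (-(j + 1)) k _
    (finite_of_subset_cells fun p hp => hp.1.1) (fun x y hxy => ?_) (fun x y hxy h1 h2 h3 => ?_)
    (fun hxy => ?_) ?_ (fun hxy => ?_)
  all_goals
    rw [Set.mem_sdiff, Finset.mem_coe, mem_ribbon] at *
    simp only [withHole, cells, Set.mem_ofPred_eq] at *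
    omega

/-- The hole of layer `j` is covered together with one of the two adjacent horizontal pairs of
layer `j + 1`; at the two ends of the layer only one of them exists. -/
theorem count_withHole {n j h : ℤ} (hj : 0 ≤ j) (hjn : j < n) (h0 : 0 ≤ h) (hh : h ≤ n - j) :
    count (withHole n j h) =
      (if h ≤ n - j - 1 then count (cutLayer n (j + 1) h) else 0) +
        (if 1 ≤ h then count (cutLayer n (j + 1) (h - 1)) else 0) := by
  have hfin : (withHole n j h).Finite := finite_of_subset_cells fun p hp => hp.1
  have hmem : (2 * j - n + h, h - j - 1) ∈ withHole n j h := by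
    simp only [withHole, cells, Set.mem_ofPred_eq, implies_true, and_true]
    omega
  have h1 : h ≤ n - j - 1 → count (withHole n j h \ ribbon (2 * j - n + h) (h - j - 1) 1 1) =
      count (cutLayer n (j + 1) h) := fun h' => by
    rw [count_withHole_sdiff hj (by omega) (by omega) (by omega), sub_add_cancel]
  have h2 : 1 ≤ h → count (withHole n j h \ ribbon (2 * j - n + h) (h - j - 1) 0 1) =
      count (cutLayer n (j + 1) (h - 1)) := fun h' => by
    rw [count_withHole_sdiff hj (by omega) (by omega) (by omega), add_zero]
  have hstart : ∀ x y e f : ℤ, (0 ≤ e ∧ e ≤ 1) → (0 ≤ f ∧ f ≤ 1) →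
      (2 * j - n + h = x ∧ h - j - 1 = y ∨ 2 * j - n + h = x + e ∧ h - j - 1 = y - 1 + e ∨
        2 * j - n + h = x + e + f ∧ h - j - 1 = y - 2 + e + f) →
      (x, y) ∈ withHole n j h → (x + e, y - 1 + e) ∈ withHole n j h →
      (x + e + f, y - 2 + e + f) ∈ withHole n j h →
      x = 2 * j - n + h ∧ y = h - j - 1 ∧ (e = 1 → h ≤ n - j - 1) ∧ (e = 0 → 1 ≤ h) ∧
        (f = 1 ∨ count (withHole n j h \ ribbon x y e f) = 0) := by
    intro x y e f he hf hm m1 m2 m3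
    have hxy : x = 2 * j - n + h ∧ y = h - j - 1 := by
      have m1' := m1.2.1
      dsimp only at m1'
      omega
    obtain ⟨rfl, rfl⟩ := hxy
    refine ⟨rfl, rfl, fun h' => ?_, fun h' => ?_, ?_⟩
    · subst h'
      simp only [withHole, cells, Set.mem_ofPred_eq] at m2
      omega
    · subst h'
      simp only [withHole, cells, Set.mem_ofPred_eq] at m2
      omega
    · obtain rfl | rfl : f = 1 ∨ f = 0 := by omega
      · exact .inl rfl
      · right
        refine count_withHole_sdiff_eq_zero hj he ?_
        convert m3 using 2 <;> ring
  have hsub : ∀ e : ℤ, (0 ≤ e ∧ e ≤ 1) → 0 ≤ h - 1 + e → h - 1 + e ≤ n - j - 1 →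
      (2 * j - n + h, h - j - 1) ∈ withHole n j h ∧
      (2 * j - n + h + e, h - j - 1 - 1 + e) ∈ withHole n j h ∧
      (2 * j - n + h + e + 1, h - j - 1 - 2 + e + 1) ∈ withHole n j h := by
    intro e he _ _
    simp only [withHole, cells, Set.mem_ofPred_eq, implies_true, and_true]
    omega
  by_cases c1 : h ≤ n - j - 1
  · by_cases c2 : 1 ≤ h
    · rw [if_pos c1, if_pos c2, ← h1 c1, ← h2 c2]
      refine count_eq_add hfin (a := 2 * j - n + h) (b := h - j - 1) _ _ _ _ _ _ _ _
        (by omega) (by omega) (mem_ribbon.2 (by omega)) (hsub 1 (by omega) (by omega) (by omega))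
        (by omega) (by omega) (mem_ribbon.2 (by omega)) (hsub 0 (by omega) (by omega) (by omega))
        ⟨2 * j - n + h + 1, h - j - 1, mem_ribbon.2 (by omega),
          fun h' => by rw [mem_ribbon] at h'; omega⟩ fun x y e f he hf hm m1 m2 m3 => ?_
      have := hstart x y e f he hf hm m1 m2 m3
      omega
    · rw [if_pos c1, if_neg c2, ← h1 c1, add_zero]
      refine count_eq_of_forced hfin (a := 2 * j - n + h) (b := h - j - 1) _ _ _ _
        (by omega) (by omega) (mem_ribbon.2 (by omega)) (hsub 1 (by omega) (by omega) (by omega))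
        fun x y e f he hf hm m1 m2 m3 => ?_
      have := hstart x y e f he hf hm m1 m2 m3
      omega
  · have c2 : 1 ≤ h := by omega
    rw [if_neg c1, if_pos c2, ← h2 c2, zero_add]
    refine count_eq_of_forced hfin (a := 2 * j - n + h) (b := h - j - 1) _ _ _ _
      (by omega) (by omega) (mem_ribbon.2 (by omega)) (hsub 0 (by omega) (by omega) (by omega))
      fun x y e f he hf hm m1 m2 m3 => ?_
    have := hstart x y e f he hf hm m1 m2 m3
    omega

theorem cutLayer_zero (n j : ℤ) : cutLayer n j 0 = withHole n j 0 := by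
  ext ⟨x, y⟩
  simp only [withHole, cutLayer, cells, Set.mem_ofPred_eq]
  omega

theorem cutLayer_self_zero (n : ℤ) : cutLayer n n 0 = ∅ := by
  ext ⟨x, y⟩
  simp only [cutLayer, cells, Set.mem_ofPred_eq, Set.mem_empty_iff_false, iff_false]
  omega

/-- The topmost horizontal pair of the cut layer is covered either together with the topmost cell on
`x - y + n + 1 = 3 * j + 2`, or with the one below it. In the second case the topmost cell becomes
the hole, and the rest of the layer is a block. -/
theorem count_cutLayer_add_one {n j d : ℤ} (hj : 1 ≤ j) (h0 : 0 ≤ d) (hd : d + 1 ≤ n - j) :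
    count (cutLayer n j (d + 1)) = count (cutLayer n j d) + count (withHole n j (d + 1)) := by
  have hfin : (cutLayer n j (d + 1)).Finite := finite_of_subset_cells fun p hp => hp.1
  obtain ⟨k, rfl⟩ := Int.eq_ofNat_of_zero_le h0
  have h1 : cutLayer n j (k + 1) \ ribbon (2 * j - n - 1 + k) (k - j) 1 1 = cutLayer n j k := by
    ext ⟨x, y⟩
    rw [Set.mem_sdiff, Finset.mem_coe, mem_ribbon]
    simp only [cutLayer, cells, Set.mem_ofPred_eq]
    omega
  have h2 : cutLayer n j (k + 1) \ ribbon (2 * j - n - 1 + k) (k - j) 1 0 =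
      withHole n j (k + 1) ∪ block (3 * j - n - 1) (-j) (-j + k) := by
    ext ⟨x, y⟩
    rw [Set.mem_sdiff, Finset.mem_coe, mem_ribbon]
    simp only [cutLayer, withHole, block, cells, Set.mem_union, Set.mem_ofPred_eq]
    omega
  rw [← h1, ← count_union_block (withHole n j (k + 1)) (3 * j - n - 1) (-j) k, ← h2]
  · refine count_eq_add hfin (a := 2 * j - n + k) (b := k - j) _ _ _ _ _ _ _ _
      (by omega) (by omega) (mem_ribbon.2 (by omega)) ?_
      (by omega) (by omega) (mem_ribbon.2 (by omega)) ?_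
      ⟨2 * j - n + k + 1, k - j, mem_ribbon.2 (by omega),
        fun h' => by rw [mem_ribbon] at h'; omega⟩ fun x y e f he hf hm m1 m2 m3 => ?_
    · simp only [cutLayer, cells, Set.mem_ofPred_eq]
      omega
    · simp only [cutLayer, cells, Set.mem_ofPred_eq]
      omega
    · by_cases hx : x - y = 3 * j - n - 1
      · simp only [cutLayer, cells, Set.mem_ofPred_eq] at m1 m2 m3
        omega
      · -- The ribbon begins at the right cell of the topmost pair and leaves the left one unpaired.
        right; right
        have hxy : x = 2 * j - n + k ∧ y = k - j := by
          have m1' := m1.2.1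
          dsimp only at m1'
          omega
        obtain ⟨rfl, rfl⟩ := hxy
        refine count_eq_zero_of_unpaired (3 * j - n - 1) (-j) k _
          hfin.sdiff (fun x y hxy => ?_) (fun x y hxy c1 c2 c3 => ?_)
          (fun hxy => ?_) ?_ (fun hxy => ?_)
        all_goals
          clear h1 h2 m1 m2 m3
          rw [Set.mem_sdiff, Finset.mem_coe, mem_ribbon] at *
          simp only [cutLayer, cells, Set.mem_ofPred_eq] at *
          omega
  · intro x y hxy
    simp only [withHole, Set.mem_ofPred_eq] at hxy
    omega
  · rw [← h2]
    exact hfin.sdiff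

/-! ### The first layer -/

/-- The benzel with layer `0` cut off so that `d` vertical pairs of cells with
`x - y + n + 1 ∈ {0, 1}` and `d + 1` cells with `x - y + n + 1 = 2` are left. -/
def cutFirstLayer (n d : ℤ) : Set Cell :=
  {p | p ∈ cells n ∧ (p.1 - p.2 ≤ -n - 1 → p.2 ≤ d) ∧
    (-n ≤ p.1 - p.2 ∧ p.1 - p.2 ≤ -n + 1 → p.2 < d)}

/-- The region `withHole n 0 h`, and next to it `d` parallel copies of a ribbon in layer `0`. -/
def withHoleAndBlock (n h d : ℤ) : Set Cell :=
  {p | p ∈ cells n ∧ (p.1 - p.2 ≤ -n - 1 → p.2 ≤ d) ∧ (p.1 - p.2 = -n → p.2 < d) ∧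
    (p.1 - p.2 = -n + 1 → p.2 < d - 1 ∨ p.2 = h - 1)}

theorem count_withHoleAndBlock {n h : ℤ} (d : ℕ) (hd : d + 1 ≤ h) (hh : h ≤ n) :
    count (withHoleAndBlock n h d) = count (withHole n 0 h) := by
  induction d with
  | zero =>
    congr 1
    ext ⟨x, y⟩
    simp only [withHole, withHoleAndBlock, cells, Set.mem_ofPred_eq]
    push_cast
    omega
  | succ d ih =>
    have hfin : (withHoleAndBlock n h (d + 1 : ℕ)).Finite :=
      finite_of_subset_cells fun p hp => hp.1
    rw [← ih (by push_cast at hd; omega),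
      count_eq_of_forced hfin (a := -n + d) (b := d + 1) (-n + d) (d + 1) 0 0 (by omega) (by omega)
      (mem_ribbon.2 (by omega))]
    · congr 1
      ext ⟨x, y⟩
      rw [Set.mem_sdiff, Finset.mem_coe, mem_ribbon]
      simp only [withHoleAndBlock, Set.mem_ofPred_eq]
      push_cast at *
      constructor
      · rintro ⟨⟨hc, h1, h2, h3⟩, h4⟩
        have := hc.2.1.1
        exact ⟨hc, by omega, by omega, by omega⟩
      · rintro ⟨hc, h1, h2, h3⟩
        exact ⟨⟨hc, by omega, by omega, by omega⟩, by omega⟩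
    · refine ⟨?_, ?_, ?_⟩ <;>
      · simp only [withHoleAndBlock, cells, Set.mem_ofPred_eq]
        push_cast at hd ⊢
        and_intros <;> omega
    · intro x y e f he hf hm m1 m2 m3
      have hxy : x = -n + d ∧ y = d + 1 := by
        have m1' := m1.1.2.1.1
        dsimp only at m1'
        omega
      obtain ⟨rfl, rfl⟩ := hxy
      simp only [withHoleAndBlock, Set.mem_ofPred_eq] at m2 m3
      push_cast at hd m2 m3
      replace m2 := m2.2.2.1
      replace m3 := m3.2.2.2
      left
      omega

/-- The analogue of `count_cutLayer_add_one` for layer `0`, where the pairs are vertical. -/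
theorem count_cutFirstLayer_succ {n : ℤ} (d : ℕ) (hd : d + 1 ≤ n) :
    count (cutFirstLayer n (d + 1)) = count (cutFirstLayer n d) + count (withHole n 0 (d + 1)) := by
  rw [← count_withHoleAndBlock d le_rfl hd]
  have h1 : cutFirstLayer n (d + 1) \ ribbon (-n + d) (d + 1) 0 1 = cutFirstLayer n d := by
    ext ⟨x, y⟩
    rw [Set.mem_sdiff, Finset.mem_coe, mem_ribbon]
    simp only [cutFirstLayer, cells, Set.mem_ofPred_eq]
    omega
  have h2 : cutFirstLayer n (d + 1) \ ribbon (-n + d) (d + 1) 0 0 =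
      withHoleAndBlock n (d + 1) d := by
    ext ⟨x, y⟩
    rw [Set.mem_sdiff, Finset.mem_coe, mem_ribbon]
    simp only [cutFirstLayer, withHoleAndBlock, cells, Set.mem_ofPred_eq]
    omega
  rw [← h1, ← h2]
  refine count_eq_add (finite_of_subset_cells fun p hp => hp.1) (a := -n + d) (b := d + 1)
    _ _ _ _ _ _ _ _
    (by omega) (by omega) (mem_ribbon.2 (by omega)) ?_
    (by omega) (by omega) (mem_ribbon.2 (by omega)) ?_
    ⟨-n + d + 1, d, mem_ribbon.2 (by omega),
      fun h' => by rw [mem_ribbon] at h'; omega⟩ fun x y e f he hf hm m1 m2 m3 => ?_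
  · simp only [cutFirstLayer, cells, Set.mem_ofPred_eq]
    omega
  · simp only [cutFirstLayer, cells, Set.mem_ofPred_eq]
    omega
  · simp only [cutFirstLayer, cells, Set.mem_ofPred_eq] at m1 m2 m3
    omega

theorem cutFirstLayer_zero (n : ℤ) : cutFirstLayer n 0 = withHole n 0 0 := by
  ext ⟨x, y⟩
  simp only [cutFirstLayer, withHole, cells, Set.mem_ofPred_eq]
  omega

theorem cutFirstLayer_self (n : ℤ) : cutFirstLayer n n = cells n := by
  ext ⟨x, y⟩
  simp only [cutFirstLayer, cells, Set.mem_ofPred_eq]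
  omega

/-! ### The Schröder triangle -/

open PowerSeries in
/-- The Schröder triangle: for `d ≤ m`, the number of lattice paths from `(0, 0)` to `(m, d)` with
steps `(1, 0)`, `(0, 1)` and `(1, 1)` that stay weakly below the diagonal. It is read off from the
powers of the generating function of the large Schröder numbers. -/
noncomputable def schroderTriangle (m d : ℕ) : ℕ :=
  coeff d (largeSchroderSeries ^ (m + 1 - d))

theorem schroderTriangle_zero_right (m : ℕ) : schroderTriangle m 0 = 1 := by
  simp [schroderTriangle]

theorem schroderTriangle_self (m : ℕ) : schroderTriangle m m = m.largeSchroder := by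
  simp [schroderTriangle]

theorem schroderTriangle_self_add_one (m : ℕ) : schroderTriangle m (m + 1) = 0 := by
  simp [schroderTriangle, PowerSeries.coeff_one]

open PowerSeries in
/-- The recursion of the Schröder triangle, from the functional equation `F = 1 + X F + X F ^ 2` of
the generating function, multiplied by `F ^ (m - d)`. -/
theorem schroderTriangle_add_one_add_one {m d : ℕ} (hd : d ≤ m) :
    schroderTriangle (m + 1) (d + 1) =
      schroderTriangle (m + 1) d + (schroderTriangle m (d + 1) + schroderTriangle m d) := by
  obtain ⟨k, rfl⟩ := Nat.exists_eq_add_of_le hd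
  have h1 : d + k + 1 + 1 - (d + 1) = k + 1 := by omega
  have h2 : d + k + 1 + 1 - d = k + 2 := by omega
  have h3 : d + k + 1 - (d + 1) = k := by omega
  have h4 : d + k + 1 - d = k + 1 := by omega
  have key : largeSchroderSeries ^ (k + 1) = X * largeSchroderSeries ^ (k + 2) +
      (largeSchroderSeries ^ k + X * largeSchroderSeries ^ (k + 1)) := by
    have h := congrArg (largeSchroderSeries ^ k * ·)
      largeSchroderSeries_eq_one_add_X_mul_largeSchroderSeries_add_X_mul_largeSchroderSeries_sq
    exact (pow_succ _ _).trans (h.trans (by ring))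
  simp only [schroderTriangle, h1, h2, h3, h4]
  conv_lhs => rw [key]
  simp only [map_add, coeff_succ_X_mul]

/-! ### The number of tilings -/

theorem count_withHole_zero_eq {n j m : ℕ} (hn : n = j + (m + 1))
    (ih : ∀ d : ℕ, d ≤ m → count (cutLayer n ((j + 1 : ℕ) : ℤ) d) = schroderTriangle m d) :
    count (withHole n j 0) = schroderTriangle (m + 1) 0 := by
  have h0 := ih 0 (Nat.zero_le m)
  push_cast at h0
  rw [count_withHole (by omega) (by omega) le_rfl (by omega), if_pos (by omega), if_neg (by omega),
    h0, schroderTriangle_zero_right, schroderTriangle_zero_right]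

theorem count_withHole_add_one_eq {n j m h : ℕ} (hn : n = j + (m + 1)) (hh : h ≤ m)
    (ih : ∀ d : ℕ, d ≤ m → count (cutLayer n ((j + 1 : ℕ) : ℤ) d) = schroderTriangle m d) :
    count (withHole n j (h + 1)) = schroderTriangle m (h + 1) + schroderTriangle m h := by
  rw [count_withHole (by omega) (by omega) (by omega) (by omega),
    if_pos (by omega : (1 : ℤ) ≤ h + 1)]
  congr 1
  · split_ifs with hc
    · rw [← ih (h + 1) (by omega)]
      push_cast
      rfl
    · obtain rfl : h = m := by omega
      rw [schroderTriangle_self_add_one]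
  · rw [← ih h hh, add_sub_cancel_right]
    push_cast
    rfl

theorem count_cutLayer (m : ℕ) :
    ∀ n j d : ℕ, 1 ≤ j → n = j + m → d ≤ m → count (cutLayer n j d) = schroderTriangle m d := by
  induction m with
  | zero =>
    intro n j d hj hn hd
    obtain rfl : n = j := hn
    obtain rfl : d = 0 := by omega
    rw [Nat.cast_zero, cutLayer_self_zero, schroderTriangle_zero_right]
    exact numTilings_empty _
  | succ m ih =>
    intro n j d hj hn hd
    have ih' : ∀ d : ℕ, d ≤ m → count (cutLayer n ((j + 1 : ℕ) : ℤ) d) = schroderTriangle m d :=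
      fun d hd => ih n (j + 1) d (by omega) (by omega) hd
    induction d with
    | zero => rw [Nat.cast_zero, cutLayer_zero, count_withHole_zero_eq hn ih']
    | succ d ihd =>
      rw [Nat.cast_succ, count_cutLayer_add_one (by omega) (by omega) (by omega), ihd (by omega),
        count_withHole_add_one_eq hn (by omega) ih', schroderTriangle_add_one_add_one (by omega)]

theorem count_cells {n : ℕ} (hn : 1 ≤ n) : count (cells n) = n.largeSchroder := by
  obtain ⟨m, rfl⟩ : ∃ m, n = m + 1 := ⟨n - 1, by omega⟩
  have ih : ∀ d : ℕ, d ≤ m →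
      count (cutLayer (m + 1 : ℕ) ((0 + 1 : ℕ) : ℤ) d) = schroderTriangle m d :=
    fun d hd => count_cutLayer m _ _ d (by omega) (by omega) hd
  have key : ∀ d : ℕ, d ≤ m + 1 →
      count (cutFirstLayer (m + 1 : ℕ) d) = schroderTriangle (m + 1) d := by
    intro d hd
    induction d with
    | zero =>
      rw [Nat.cast_zero, cutFirstLayer_zero, ← count_withHole_zero_eq (by omega) ih, Nat.cast_zero]
    | succ d ihd =>
      rw [Nat.cast_succ d, count_cutFirstLayer_succ d (by omega), ihd (by omega),
        schroderTriangle_add_one_add_one (by omega),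
        ← count_withHole_add_one_eq (by omega) (by omega) ih, Nat.cast_zero]
  rw [← cutFirstLayer_self, key _ le_rfl, schroderTriangle_self]

/-! ### The cells of the benzel -/

theorem omega_eq : omega = ⟨-1 / 2, √3 / 2⟩ := by
  have h : (2 * Real.pi * Complex.I / 3 : ℂ) = ((Real.pi - Real.pi / 3 : ℝ) : ℂ) * Complex.I := by
    push_cast
    ring
  rw [omega, h, Complex.exp_mul_I, ← Complex.ofReal_cos, ← Complex.ofReal_sin, Real.cos_pi_sub,
    Real.sin_pi_sub, Real.cos_pi_div_three, Real.sin_pi_div_three]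
  apply Complex.ext <;> simp
  norm_num

theorem omega_sq : omega ^ 2 = -1 - omega := by
  have h3 : √3 * √3 = 3 := Real.mul_self_sqrt (by norm_num)
  rw [omega_eq, sq]
  apply Complex.ext <;> simp <;> nlinarith

/-- The linear map `(p, q) ↦ p + q * ω`. -/
noncomputable def eisenstein : ℝ × ℝ →ₗ[ℝ] ℂ where
  toFun v := v.1 + v.2 * omega
  map_add' v w := by
    simp only [Prod.fst_add, Prod.snd_add]
    push_cast
    ring
  map_smul' r v := by
    simp only [Prod.smul_fst, Prod.smul_snd, smul_eq_mul, Complex.real_smul, RingHom.id_apply]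
    push_cast
    ring

theorem eisenstein_apply (p q : ℝ) : eisenstein (p, q) = p + q * omega := rfl

theorem eisenstein_injective : Function.Injective eisenstein := by
  rw [injective_iff_map_eq_zero]
  rintro ⟨p, q⟩ h
  rw [eisenstein_apply, omega_eq] at h
  have him := congrArg Complex.im h
  have hre := congrArg Complex.re h
  simp at him hre
  subst him
  simp at hre
  simp [hre]

theorem range_fin_three {α : Type*} (f : Fin 3 → α) : Set.range f = {f 0, f 1, f 2} := by
  ext x
  simp [Fin.exists_fin_succ, eq_comm]

/-- The six points `±(1, 0)`, `±(0, 1)`, `±(1, 1)`, translated by `(p, q)`. -/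
def hexagonVertices (p q : ℝ) : Set (ℝ × ℝ) :=
  {(p + 1, q), (p, q + 1), (p - 1, q - 1), (p - 1, q), (p, q - 1), (p + 1, q + 1)}

theorem hexagon_eq (x y : ℤ) :
    hexagon (x, y) = eisenstein '' convexHull ℝ (hexagonVertices (1 + x + 2 * y) (y - x)) := by
  have h2 := omega_sq
  rw [hexagon, LinearMap.image_convexHull, range_fin_three, range_fin_three]
  congr 1
  simp only [hexagonVertices, Set.image_insert_eq, Set.image_singleton, eisenstein_apply, center,
    Fin.val_zero, Fin.val_one, Fin.val_two, h2, pow_zero, pow_one, Set.insert_union,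
    Set.singleton_union]
  push_cast
  ring_nf

/-- The vertices of the bounding hexagon of the `(a, b)`-benzel in the basis `1`, `ω`. -/
def boundingVertices (a b : ℝ) : Set (ℝ × ℝ) :=
  {(b, a), (-a, b - a), (a - b, -b), (-a, -b), (b, b - a), (a - b, a)}

theorem boundingHexagon_eq (a b : ℕ) :
    boundingHexagon a b = eisenstein '' convexHull ℝ (boundingVertices a b) := by
  have h2 := omega_sq
  rw [boundingHexagon, LinearMap.image_convexHull, range_fin_three, range_fin_three]
  congr 1
  simp only [boundingVertices, Set.image_insert_eq, Set.image_singleton, eisenstein_apply,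
    Fin.val_zero, Fin.val_one, Fin.val_two, pow_zero, pow_one, Set.insert_union,
    Set.singleton_union]
  have e1 : omega * (a * omega + b) = -a + (b - a) * omega := by linear_combination a * h2
  have e2 : omega ^ 2 * (a * omega + b) = (a - b) + -b * omega := by
    linear_combination (a * omega + b - a) * h2
  have e3 : -(omega * (a + b * omega)) = b + (b - a) * omega := by linear_combination -b * h2
  have e4 : -(omega ^ 2 * (a + b * omega)) = (a - b) + a * omega := by
    linear_combination (-b * omega - a + b) * h2
  rw [e1, e2, e3, e4]
  push_cast
  ring_nf

/-- A convex set is order-connected along every line, given here by a point and a direction. -/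
theorem convex_mk_add_mul_mem {C : Set (ℝ × ℝ)} (hC : Convex ℝ C) {u v w z r₁ r r₂ : ℝ}
    (h₁ : (u + r₁ * w, v + r₁ * z) ∈ C) (h₂ : (u + r₂ * w, v + r₂ * z) ∈ C)
    (hr₁ : r₁ ≤ r) (hr₂ : r ≤ r₂) : (u + r * w, v + r * z) ∈ C := by
  have h := (hC.affine_preimage (AffineMap.lineMap ((u, v) : ℝ × ℝ) (u + w, v + z))).ordConnected
  have key (s : ℝ) : AffineMap.lineMap ((u, v) : ℝ × ℝ) (u + w, v + z) s =
      (u + s * w, v + s * z) := by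
    simp [AffineMap.lineMap_apply, add_comm]
  have := h.out (x := r₁) (y := r₂) (by rw [Set.mem_preimage, key]; exact h₁)
    (by rw [Set.mem_preimage, key]; exact h₂) ⟨hr₁, hr₂⟩
  rwa [Set.mem_preimage, key] at this

/-- The bounding hexagon by inequalities, in the basis `1`, `ω`. -/
theorem mem_convexHull_boundingVertices {a b : ℝ} (hab : a ≤ 2 * b) (hba : b ≤ 2 * a) (p q : ℝ) :
    (p, q) ∈ convexHull ℝ (boundingVertices a b) ↔
      (-a ≤ p ∧ p ≤ b) ∧ (-b ≤ q ∧ q ≤ a) ∧ (-a ≤ q - p ∧ q - p ≤ b) := by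
  constructor
  · let C : Set (ℝ × ℝ) := LinearMap.fst ℝ ℝ ℝ ⁻¹' Set.Icc (-a) b ∩
      (LinearMap.snd ℝ ℝ ℝ ⁻¹' Set.Icc (-b) a ∩
        (LinearMap.snd ℝ ℝ ℝ - LinearMap.fst ℝ ℝ ℝ) ⁻¹' Set.Icc (-a) b)
    have hC : Convex ℝ C := ((convex_Icc _ _).linear_preimage _).inter
      (((convex_Icc _ _).linear_preimage _).inter ((convex_Icc _ _).linear_preimage _))
    have hmem (v : ℝ × ℝ) : v ∈ C ↔ (-a ≤ v.1 ∧ v.1 ≤ b) ∧ (-b ≤ v.2 ∧ v.2 ≤ a) ∧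
        (-a ≤ v.2 - v.1 ∧ v.2 - v.1 ≤ b) := Iff.rfl
    intro h
    refine (hmem (p, q)).1 (convexHull_min (fun v hv => ?_) hC h)
    rw [hmem]
    simp only [boundingVertices, Set.mem_insert_iff, Set.mem_singleton_iff] at hv
    rcases hv with rfl | rfl | rfl | rfl | rfl | rfl <;> and_intros <;> dsimp only <;> linarith
  · rintro ⟨⟨h1, h2⟩, ⟨h3, h4⟩, h5, h6⟩
    have hC := convex_convexHull ℝ (boundingVertices a b)
    have hV : boundingVertices a b ⊆ convexHull ℝ (boundingVertices a b) :=
      subset_convexHull ℝ _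
    generalize convexHull ℝ (boundingVertices a b) = C at hC hV
    simp only [boundingVertices, Set.insert_subset_iff, Set.singleton_subset_iff] at hV
    obtain ⟨v1, v2, v3, v4, v5, v6⟩ := hV
    -- The horizontal line through the point meets the boundary in two points. Which edges they
    -- lie on depends on the position of `q` relative to `b - a`.
    have horizontal (l r : ℝ) (hl : (l, q) ∈ C) (hr : (r, q) ∈ C) (hlp : l ≤ p) (hpr : p ≤ r) :
        (p, q) ∈ C := by
      have := convex_mk_add_mul_mem hC (u := 0) (v := q) (w := 1) (z := 0) (r₁ := l) (r₂ := r)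
        (by simpa using hl) (by simpa using hr) hlp hpr
      simpa using this
    have vertical (x y₁ y₂ : ℝ) (hl : (x, y₁) ∈ C) (hr : (x, y₂) ∈ C) (hlp : y₁ ≤ q)
        (hpr : q ≤ y₂) : (x, q) ∈ C := by
      have := convex_mk_add_mul_mem hC (u := x) (v := 0) (w := 0) (z := 1) (r₁ := y₁) (r₂ := y₂)
        (by simpa using hl) (by simpa using hr) hlp hpr
      simpa using this
    have diagonal (x y₁ y₂ : ℝ) (hl : (x + y₁, y₁) ∈ C) (hr : (x + y₂, y₂) ∈ C) (hlp : y₁ ≤ q)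
        (hpr : q ≤ y₂) : (x + q, q) ∈ C := by
      have := convex_mk_add_mul_mem hC (u := x) (v := 0) (w := 1) (z := 1) (r₁ := y₁) (r₂ := y₂)
        (by simpa using hl) (by simpa using hr) hlp hpr
      simpa using this
    rcases le_total q (b - a) with hq | hq
    · refine horizontal (-a) (a + q) (vertical _ _ _ v4 v2 h3 hq)
        (diagonal _ (-b) (b - a) ?_ ?_ h3 hq) h1 (by linarith)
      · rwa [← sub_eq_add_neg]
      · rwa [add_sub_cancel]
    · refine horizontal (-b + q) b (diagonal _ (b - a) a ?_ ?_ hq h4) (vertical _ _ _ v5 v1 hq h4)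
        (by linarith) h2
      · rwa [show -b + (b - a) = -a by ring]
      · rwa [neg_add_eq_sub]

theorem benzel_eq_cells {n : ℕ} (hn : 1 ≤ n) : benzel (n + 2) (2 * n + 1) = cells n := by
  ext ⟨x, y⟩
  have hn' : (1 : ℝ) ≤ n := by exact_mod_cast hn
  have key := mem_convexHull_boundingVertices (a := (n + 2 : ℕ)) (b := (2 * n + 1 : ℕ))
    (by push_cast; linarith) (by push_cast; linarith)
  rw [benzel, Set.mem_ofPred_eq, hexagon_eq, boundingHexagon_eq,
    Set.image_subset_image_iff eisenstein_injective,
    (convex_convexHull ℝ _).convexHull_subset_iff]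
  simp only [hexagonVertices, Set.insert_subset_iff, Set.singleton_subset_iff, key, cells,
    Set.mem_ofPred_eq, le_sub_iff_add_le]
  -- The inequalities hold between integers.
  norm_cast
  omega

end Benzel

open PowerSeries in
theorem proposition3p4 (T : ℕ → ℕ) (hT₀ : T 0 = 1)
    (hT : ∀ n : ℕ, 1 ≤ n → T n =
      Benzel.numTilings
        {Benzel.Prototile.leftStone, Benzel.Prototile.rightStone,
          Benzel.Prototile.risingBone, Benzel.Prototile.fallingBone}
        (Benzel.benzel (n + 2) (2 * n + 1))) :
    (∀ n : ℕ, T n = Nat.largeSchroder n) ∧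
    ∃ S : PowerSeries ℚ,
      PowerSeries.constantCoeff S = 1 ∧
      S ^ 2 = 1 - 6 * PowerSeries.X + PowerSeries.X ^ 2 ∧
      2 * PowerSeries.X * PowerSeries.mk (fun n => (T n : ℚ)) = 1 - PowerSeries.X - S := by
  have hL : ∀ n : ℕ, T n = Nat.largeSchroder n := by
    intro n
    rcases Nat.eq_zero_or_pos n with rfl | hn
    · rw [hT₀, Nat.largeSchroder_zero]
    · rw [hT n hn, Benzel.benzel_eq_cells hn]
      exact Benzel.count_cells hn
  refine ⟨hL, 1 - X - 2 * X * mk fun n => (T n : ℚ), by simp, ?_, by ring⟩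
  have hF : (mk fun n => (T n : ℚ)) = largeSchroderSeries.map (Nat.castRingHom ℚ) := by
    ext n
    simp [hL]
  have h := congrArg (PowerSeries.map (Nat.castRingHom ℚ))
    largeSchroderSeries_eq_one_add_X_mul_largeSchroderSeries_add_X_mul_largeSchroderSeries_sq
  simp only [map_add, map_mul, map_pow, map_one, map_X] at h
  rw [hF]
  linear_combination -4 * X * h
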